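/- All graphs are finite and simple. A plane graph is a graph drawn in the plane without crossings (vertices are distinct points, edges are simple arcs joining their ends, and arcs meet vertices and each other only in common ends); a graph is planar if it has such a drawing. A $5$-coloring is a proper vertex coloring with colors from $\{1,\dots,5\}$. For a coloring $\varphi$ of a graph $N$ and two distinct colors $a,b$, a Kempe chain in colors $\{a,b\}$ is a maximal connected subgraph of $N$ all of whose vertices have color $a$ or $b$; a K-change swaps the colors $a$ and $b$ on one such Kempe chain. A sequence of K-changes avoids a color $c$ if no vertex changes its color to $c$ in any K-change of the sequence. A vertex $v$ of degree $6$ in $N$ is $\varphi$-good if, in $\varphi$, either $v$ has three neighbors colored alike, or $v$ has two disjoint pairs $\{a,b\}$, $\{c,d\}$ of neighbors with $\varphi(a)=\varphi(b)$ and $\varphi(c)=\varphi(d)$ that are non-overlapping, i.e. such that the graph $N-v+ab+cd$ is planar. **Lemma.** Let $N$ be a plane graph, let $\alpha$ be a $5$-coloring of $N$, and let $v\in V(N)$ be a vertex of degree $6$. Then there is a sequence of at most three K-changes avoiding the color $\alpha(v)$ that transforms $\alpha$ into a $5$-coloring $\beta$ of $N$ such that $v$ is $\beta$-good. -/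

import Mathlib

/-- `A` is a (simple) arc in the Euclidean plane, taken to be `ℂ`, with ends `x` and `y`:
the image of an injective continuous map from `[0, 1]` to the plane that sends `0` to `x` and
`1` to `y`. -/
def IsArc (x y : ℂ) (A : Set ℂ) : Prop :=
  ∃ γ : Path x y, Function.Injective γ ∧ Set.range γ = A

namespace SimpleGraph

/-- A drawing of the graph `G` in the plane without crossings. The vertices are distinct points,
every edge is an arc joining its two ends, an arc contains no vertex other than its ends,
and two different arcs meet only in a common end of the two edges.
A graph together with such a drawing is a plane graph. -/
structure PlaneDrawing {V : Type*} (G : SimpleGraph V) where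
  pos : V → ℂ
  arc : G.edgeSet → Set ℂ
  pos_injective : Function.Injective pos
  isArc_arc : ∀ (u w : V) (h : G.Adj u w), IsArc (pos u) (pos w) (arc ⟨s(u, w), h⟩)
  mem_of_pos_mem_arc : ∀ (e : G.edgeSet) (x : V), pos x ∈ arc e → x ∈ e.1
  exists_of_mem_arc_of_mem_arc : ∀ e f : G.edgeSet, e ≠ f → ∀ p : ℂ, p ∈ arc e → p ∈ arc f →
    ∃ x : V, x ∈ e.1 ∧ x ∈ f.1 ∧ pos x = p

/-- A graph is planar if it can be drawn in the plane without crossings. -/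
def IsPlanar {V : Type*} (G : SimpleGraph V) : Prop :=
  Nonempty G.PlaneDrawing

variable {V : Type*} {G : SimpleGraph V} {k : ℕ}

/-- `K` is the vertex set of a Kempe chain in the colors `a`, `b`, that is, of a maximal connected
subgraph all of whose vertices have color `a` or `b`. -/
def Coloring.IsKempeChain (φ : G.Coloring (Fin k)) (a b : Fin k) (K : Set V) : Prop :=
  ∃ C : (G.induce {w : V | φ w = a ∨ φ w = b}).ConnectedComponent, K = Subtype.val '' C.supp

/-- `ψ` is obtained from `φ` by a single K-change: the two colors of a Kempe chain are swapped
on that chain. -/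
def Coloring.IsKempeChange (φ ψ : G.Coloring (Fin k)) : Prop :=
  ∃ (a b : Fin k) (K : Set V), a ≠ b ∧ φ.IsKempeChain a b K ∧
    (∀ w ∈ K, ψ w = Equiv.swap a b (φ w)) ∧ ∀ w ∉ K, ψ w = φ w

/-- There is a sequence of exactly `m` K-changes from `φ` to `ψ` that avoids the color `c`:
no vertex ever changes its color to `c`. -/
def Coloring.KempeReachableAvoiding (c : Fin k) (m : ℕ) (φ ψ : G.Coloring (Fin k)) : Prop :=
  ∃ γ : ℕ → G.Coloring (Fin k), γ 0 = φ ∧ γ m = ψ ∧ ∀ i < m,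
    (γ i).IsKempeChange (γ (i + 1)) ∧ ∀ w : V, γ (i + 1) w ≠ γ i w → γ (i + 1) w ≠ c

/-- The pairs `(a, b)` and `(c, d)` of vertices other than `v` are non-overlapping at `v`:
the graph `G - v + ab + cd` is planar. -/
def NonOverlapping (G : SimpleGraph V) (v : V) (a b c d : ({v}ᶜ : Set V)) : Prop :=
  (G.induce ({v}ᶜ : Set V) ⊔ edge a b ⊔ edge c d).IsPlanar

/-- The vertex `v` is `φ`-good (used for vertices of degree `6`): it has three neighbors colored
alike, or two non-overlapping pairs of neighbors such that each pair is colored alike. -/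
def Coloring.IsGood (φ : G.Coloring (Fin k)) (v : V) : Prop :=
  (∃ a b c : V, G.Adj v a ∧ G.Adj v b ∧ G.Adj v c ∧ a ≠ b ∧ a ≠ c ∧ b ≠ c ∧
    φ a = φ b ∧ φ b = φ c) ∨
  ∃ a b c d : ({v}ᶜ : Set V), G.Adj v a ∧ G.Adj v b ∧ G.Adj v c ∧ G.Adj v d ∧
    [a, b, c, d].Nodup ∧ φ a = φ b ∧ φ c = φ d ∧ G.NonOverlapping v a b c d

end SimpleGraph

/-! The neighbors of `v` carry only the four colors other than `α v`. K-changes within these four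
colors avoid `α v` and never move `v`. Two Kempe chains in complementary pairs of these colors are
disjoint and miss `v`, so by planarity they cannot join interleaved pairs of neighbors
(`not_linked_of_linked`). This gives a dichotomy: if two neighbors are linked by a chain, a swap in
the other two colors at a neighbor on one side leaves the other side alone; if they are not linked,
a swap at one of them leaves the other alone.

Up to rotation, six cyclically placed colors out of four are good already or form `x ? x z y w`, `x
z y x w y` or `x y z x y z`. These need at most one, two and three K-changes: each dichotomy ends in
a good coloring or in an earlier pattern of the list.

The topology takes place at a small disc about `v`, the neighbors being ordered by the points where
their edges, traced towards `v`, first reach it. Disjoint chords, prolonged by the outer pieces of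
the edges, draw two new edges in place of `v`. Conversely, crossing chains would give disjoint sets
outside the disc joining interleaved points of its boundary. Inversion moves them inside, where the
corresponding paths must meet: otherwise the difference of the two paths would have a continuous
logarithm on a square, against a count of its increments along the four sides
(`exists_eq_of_interleaved`). -/

section

/-! ### Paths in a disc with interleaved ends -/

open Complex Set Real

/-- A continuous nowhere vanishing function on the plane has a continuous logarithm. -/
theorem exists_continuous_log {F : ℝ × ℝ → ℂ} (hF : Continuous F) (h0 : ∀ x, F x ≠ 0) :
    ∃ L : ℝ × ℝ → ℂ, Continuous L ∧ ∀ x, Complex.exp (L x) = F x := by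
  -- The plane is simply connected, so `F` lifts through the covering map `exp`.
  obtain ⟨L, ⟨-, hL⟩, -⟩ := Complex.isCoveringMap_exp.existsUnique_continuousMap_lifts
    (A := ℝ × ℝ) ⟨fun x => (⟨F x, h0 x⟩ : {z : ℂ // z ≠ 0}), by fun_prop⟩ (0, 0)
    (Complex.log (F (0, 0))) (Subtype.ext (Complex.exp_log (h0 _)))
  exact ⟨L, L.continuous, fun x => congrArg Subtype.val (congrFun hL x)⟩

/-- Two continuous logarithms of proportional functions on the line have the same increments. -/
theorem log_increment_eq {h k : ℝ → ℂ} (hh : Continuous h) (hk : Continuous k) (c : ℂ)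
    (e : ∀ t, Complex.exp (h t) = c * Complex.exp (k t)) (s t : ℝ) : h t - h s = k t - k s := by
  have hs := e s
  have := Complex.isCoveringMap_exp.eq_of_comp_eq (A := ℝ) hh
    (show Continuous fun x => k x + (h s - k s) by fun_prop) (by
      funext x
      refine Subtype.ext ?_
      simp only [Function.comp]
      rw [e x, Complex.exp_add, Complex.exp_sub, hs]
      field_simp [Complex.exp_ne_zero]) s (by ring)
  have := congrFun this t
  rw [this]; ring

/-- A logarithm of `t ↦ c * u t`, with `u` in the slit plane, has the increments of `log u`. -/
theorem im_log_increment_eq {h u : ℝ → ℂ} (hh : Continuous h) (hu : Continuous u)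
    (hs : ∀ t, u t ∈ slitPlane) (c : ℂ) (e : ∀ t, Complex.exp (h t) = c * u t) (s t : ℝ) :
    (h t).im - (h s).im = (u t).arg - (u s).arg := by
  have := log_increment_eq hh (hu.clog hs) c
    (fun t => by rw [Complex.exp_log (slitPlane_ne_zero (hs t)), e]) s t
  simpa [Complex.log_im] using congrArg Complex.im this

/-- The quotient `z / p` lies in the closed unit disc, whose only point of real part `1` is `1`
itself. -/
theorem one_sub_div_mem_slitPlane {p z : ℂ} (hp : ‖p‖ = 1) (hz : ‖z‖ ≤ 1) (h : p - z ≠ 0) :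
    1 - z / p ∈ slitPlane := by
  have hp0 : p ≠ 0 := by rintro rfl; simp at hp
  refine Or.inl ?_
  have h1 : ‖z / p‖ ≤ 1 := by rw [norm_div, hp, div_one]; exact hz
  have h2 : (z / p).re ≤ 1 := (Complex.re_le_norm _).trans h1
  rcases h2.lt_or_eq with h3 | h3
  · simpa using h3
  · exfalso
    have h4 : ‖z / p‖ = (z / p).re := le_antisymm (h1.trans h3.ge) (Complex.re_le_norm _)
    have h5 : (z / p).im = 0 := by
      have := Complex.sq_norm_sub_sq_re (z / p)
      rw [h4, sub_self] at this
      exact pow_eq_zero_iff two_ne_zero |>.1 this.symm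
    have h6 : z / p = 1 := Complex.ext h3 h5
    rw [div_eq_one_iff_eq hp0] at h6
    exact h (sub_eq_zero.2 h6.symm)

/-- This is the identity `1 - exp (i x) = 2 sin (x / 2) exp (i (x - π) / 2)`. -/
theorem arg_one_sub_exp {x : ℝ} (h0 : 0 < x) (h1 : x < 2 * π) :
    (1 - Complex.exp (x * I)).arg = (x - π) / 2 := by
  have hs : 0 < 2 * Real.sin (x / 2) := by
    have := Real.sin_pos_of_pos_of_lt_pi (x := x / 2) (by linarith) (by linarith)
    linarith
  rw [← Complex.arg_mul_cos_add_sin_mul_I hs (θ := (x - π) / 2)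
    ⟨by linarith [Real.pi_pos], by linarith [Real.pi_pos]⟩]
  congr 1
  rw [← Complex.ofReal_cos, ← Complex.ofReal_sin, show (x - π) / 2 = x / 2 - π / 2 by ring,
    Real.cos_sub_pi_div_two, Real.sin_sub_pi_div_two, Complex.exp_mul_I, ← Complex.ofReal_cos,
    ← Complex.ofReal_sin]
  have e1 : Real.cos x = 1 - 2 * Real.sin (x / 2) ^ 2 := by
    conv_lhs => rw [show x = 2 * (x / 2) by ring, Real.cos_two_mul]
    have := Real.sin_sq_add_cos_sq (x / 2)
    linarith
  have e2 : Real.sin x = 2 * Real.sin (x / 2) * Real.cos (x / 2) := by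
    conv_lhs => rw [show x = 2 * (x / 2) by ring, Real.sin_two_mul]
  rw [e1, e2]
  push_cast
  ring

theorem arg_one_sub_exp_neg {x : ℝ} (h0 : x < 0) (h1 : -(2 * π) < x) :
    (1 - Complex.exp (x * I)).arg = (x + π) / 2 := by
  have := arg_one_sub_exp (x := x + 2 * π) (by linarith) (by linarith)
  rw [show ((x + 2 * π : ℝ) : ℂ) * I = x * I + 2 * π * I by push_cast; ring,
    Complex.exp_periodic] at this
  rw [this]; ring

/-- Two paths in the closed unit disc that join interleaved points of the unit circle meet. -/
theorem exists_eq_of_interleaved {a b c d : ℝ} (hab : a < b) (hbc : b < c) (hcd : c < d)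
    (hda : d < a + 2 * π)
    (f : Path (Complex.exp (a * I)) (Complex.exp (c * I)))
    (g : Path (Complex.exp (b * I)) (Complex.exp (d * I)))
    (hf : ∀ t, ‖f t‖ ≤ 1) (hg : ∀ t, ‖g t‖ ≤ 1) : ∃ s t, f s = g t := by
  by_contra! hne
  have hfe : ∀ t, ‖f.extend t‖ ≤ 1 := fun t =>
    hf (projIcc 0 1 zero_le_one t)
  have hge : ∀ t, ‖g.extend t‖ ≤ 1 := fun t =>
    hg (projIcc 0 1 zero_le_one t)
  have hfg : ∀ s t, f.extend s - g.extend t ≠ 0 := fun s t =>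
    sub_ne_zero.2 (hne (projIcc 0 1 zero_le_one s) (projIcc 0 1 zero_le_one t))
  have hfc : Continuous f.extend := f.continuous_extend
  have hgc : Continuous g.extend := g.continuous_extend
  -- The increment of `L.im` from `(0, 0)` to `(1, 1)` is computed along both pairs of sides of the
  -- unit square. On each side one path rests at a point of the circle, so the increment is a
  -- difference of principal arguments. Via `(0, 1)` it is `(d - b) / 2 + (c - a) / 2`; via `(1, 0)`
  -- it is less by `2 * π`, as the sign of the angle difference changes on both of those sides.
  obtain ⟨L, hL, hexp⟩ := exists_continuous_log (F := fun x => f.extend x.1 - g.extend x.2)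
    (by fun_prop) (fun x => hfg _ _)
  have n1 : ∀ x : ℝ, ‖Complex.exp (x * I)‖ = 1 := Complex.norm_exp_ofReal_mul_I
  have key : ∀ x y : ℝ, Complex.exp (x * I) / Complex.exp (y * I)
      = Complex.exp (((x - y : ℝ) : ℂ) * I) := fun x y => by
    rw [← Complex.exp_sub]; push_cast; ring_nf
  have A1 := im_log_increment_eq (h := fun t => L (0, t))
    (u := fun t => 1 - g.extend t / Complex.exp (a * I)) (by fun_prop) (by fun_prop)
    (fun t => one_sub_div_mem_slitPlane (n1 a) (hge t) (by simpa using hfg 0 t))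
    (Complex.exp (a * I)) (fun t => by
      rw [hexp]; simp only [Path.extend_zero]; field_simp [Complex.exp_ne_zero]) 0 1
  have A3 := im_log_increment_eq (h := fun t => L (1, t))
    (u := fun t => 1 - g.extend t / Complex.exp (c * I)) (by fun_prop) (by fun_prop)
    (fun t => one_sub_div_mem_slitPlane (n1 c) (hge t) (by simpa using hfg 1 t))
    (Complex.exp (c * I)) (fun t => by
      rw [hexp]; simp only [Path.extend_one]; field_simp [Complex.exp_ne_zero]) 0 1
  have A2 := im_log_increment_eq (h := fun t => L (t, 1))
    (u := fun t => 1 - f.extend t / Complex.exp (d * I)) (by fun_prop) (by fun_prop)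
    (fun t => one_sub_div_mem_slitPlane (n1 d) (hfe t)
      (by rw [← neg_ne_zero]; simpa using hfg t 1))
    (-Complex.exp (d * I)) (fun t => by
      rw [hexp]; simp only [Path.extend_one]; field_simp [Complex.exp_ne_zero]; ring) 0 1
  have A4 := im_log_increment_eq (h := fun t => L (t, 0))
    (u := fun t => 1 - f.extend t / Complex.exp (b * I)) (by fun_prop) (by fun_prop)
    (fun t => one_sub_div_mem_slitPlane (n1 b) (hfe t)
      (by rw [← neg_ne_zero]; simpa using hfg t 0))
    (-Complex.exp (b * I)) (fun t => by
      rw [hexp]; simp only [Path.extend_zero]; field_simp [Complex.exp_ne_zero]; ring) 0 1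
  simp only [Path.extend_zero, Path.extend_one, key] at A1 A2 A3 A4
  rw [arg_one_sub_exp (by linarith) (by linarith), arg_one_sub_exp (by linarith) (by linarith)]
    at A1
  rw [arg_one_sub_exp_neg (by linarith) (by linarith),
    arg_one_sub_exp_neg (by linarith) (by linarith)] at A2
  rw [arg_one_sub_exp (by linarith) (by linarith),
    arg_one_sub_exp_neg (by linarith) (by linarith)] at A3
  rw [arg_one_sub_exp (by linarith) (by linarith),
    arg_one_sub_exp_neg (by linarith) (by linarith)] at A4
  linarith [Real.pi_pos]

/-- Outside an open disc, disjoint connected sets cannot join interleaved points of its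
boundary circle. -/
theorem not_joinedIn_of_interleaved {o : ℂ} {r : ℝ} (hr : 0 < r) {a b c d : ℝ} (hab : a < b)
    (hbc : b < c) (hcd : c < d) (hda : d < a + 2 * π) {S T : Set ℂ} (hST : Disjoint S T)
    (hS : ∀ z ∈ S, r ≤ dist z o) (hT : ∀ z ∈ T, r ≤ dist z o)
    (hac : JoinedIn S (o + r * Complex.exp (a * I)) (o + r * Complex.exp (c * I)))
    (hbd : JoinedIn T (o + r * Complex.exp (b * I)) (o + r * Complex.exp (d * I))) : False := by
  obtain ⟨f, hf⟩ := hac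
  obtain ⟨g, hg⟩ := hbd
  -- Inversion in the circle, rescaled to the unit circle. As `0⁻¹ = 0`, it is injective on the
  -- whole plane.
  let inv : ℂ → ℂ := fun z => ((starRingEnd ℂ) ((z - o) / r))⁻¹
  have hr' : (r : ℂ) ≠ 0 := by exact_mod_cast hr.ne'
  have hnorm : ∀ z, r ≤ dist z o → 1 ≤ ‖(z - o) / r‖ := fun z hz => by
    rw [norm_div, Complex.norm_real, Real.norm_of_nonneg hr.le, one_le_div hr, ← dist_eq_norm]
    exact hz
  have hinv : ∀ z, r ≤ dist z o → ‖inv z‖ ≤ 1 := fun z hz => by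
    simp only [inv, norm_inv, RCLike.norm_conj]
    exact inv_le_one_of_one_le₀ (hnorm z hz)
  have hcirc : ∀ x : ℝ, inv (o + r * Complex.exp (x * I)) = Complex.exp (x * I) := fun x => by
    simp only [inv, add_sub_cancel_left, mul_div_cancel_left₀ _ hr']
    rw [← Complex.exp_conj, ← Complex.exp_neg]
    simp
  have hcont : ∀ h : unitInterval → ℂ, Continuous h → (∀ t, r ≤ dist (h t) o) →
      Continuous fun t => inv (h t) := fun h hh h1 => by
    refine Continuous.inv₀ ?_ fun t h0 => ?_
    · exact Complex.continuous_conj.comp (by fun_prop)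
    · have := hnorm _ (h1 t)
      rw [map_eq_zero] at h0
      rw [h0, norm_zero] at this
      linarith
  have hinj : Function.Injective inv := fun z w h => by
    have h1 := (starRingEnd ℂ).injective (inv_injective h)
    field_simp at h1
    linear_combination h1
  obtain ⟨s, t, hst⟩ := exists_eq_of_interleaved hab hbc hcd hda
    ⟨⟨fun t => inv (f t), hcont _ f.continuous fun t => hS _ (hf t)⟩,
      by simp [hcirc], by simp [hcirc]⟩
    ⟨⟨fun t => inv (g t), hcont _ g.continuous fun t => hT _ (hg t)⟩,
      by simp [hcirc], by simp [hcirc]⟩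
    (fun t => hinv _ (hS _ (hf t))) (fun t => hinv _ (hT _ (hg t)))
  exact Set.disjoint_left.1 hST (hf s) (hinj hst ▸ hg t)

end

section

/-! ### Arcs, chords and drawings -/

section Arc

variable {x y z : ℂ} {A B : Set ℂ}

theorem IsArc.symm (h : IsArc x y A) : IsArc y x A := by
  obtain ⟨γ, hγ, rfl⟩ := h
  exact ⟨γ.symm, hγ.comp unitInterval.symm_bijective.injective, γ.symm_range⟩

theorem IsArc.left_mem (h : IsArc x y A) : x ∈ A := by
  obtain ⟨γ, -, rfl⟩ := h
  exact ⟨0, γ.source⟩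

theorem IsArc.right_mem (h : IsArc x y A) : y ∈ A := h.symm.left_mem

theorem IsArc.isClosed (h : IsArc x y A) : IsClosed A := by
  obtain ⟨γ, -, rfl⟩ := h
  exact (isCompact_range γ.continuous).isClosed

theorem IsArc.joinedIn (h : IsArc x y A) : JoinedIn A x y := by
  obtain ⟨γ, -, rfl⟩ := h
  exact ⟨γ, fun t => ⟨t, rfl⟩⟩

theorem IsArc.trans (hA : IsArc x y A) (hB : IsArc y z B) (h : ∀ p ∈ A, p ∈ B → p = y) :
    IsArc x z (A ∪ B) := by
  obtain ⟨γ, hγ, rfl⟩ := hA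
  obtain ⟨δ, hδ, rfl⟩ := hB
  refine ⟨γ.trans δ, ?_, Path.trans_range γ δ⟩
  have key : ∀ s t : unitInterval, (s : ℝ) ≤ 1 / 2 → ¬ (t : ℝ) ≤ 1 / 2 →
      γ.trans δ s = γ.trans δ t → False := by
    intro s t hs ht hst
    rw [Path.trans_apply, Path.trans_apply, dif_pos hs, dif_neg ht] at hst
    have h1 := h _ ⟨_, hst⟩ ⟨_, rfl⟩
    have h2 := hδ (h1.trans δ.source.symm)
    have h3 := congrArg Subtype.val h2
    simp only [Set.Icc.coe_zero] at h3
    apply ht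
    linarith
  intro s t hst
  by_cases hs : (s : ℝ) ≤ 1 / 2 <;> by_cases ht : (t : ℝ) ≤ 1 / 2
  · rw [Path.trans_apply, Path.trans_apply, dif_pos hs, dif_pos ht] at hst
    have h3 := congrArg Subtype.val (hγ hst)
    simp only at h3
    exact Subtype.ext (by linarith)
  · exact (key s t hs ht hst).elim
  · exact (key t s ht hs hst.symm).elim
  · rw [Path.trans_apply, Path.trans_apply, dif_neg hs, dif_neg ht] at hst
    have h3 := congrArg Subtype.val (hδ hst)
    simp only at h3
    exact Subtype.ext (by linarith)

theorem isArc_segment (h : x ≠ y) : IsArc x y (segment ℝ x y) := by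
  refine ⟨⟨⟨fun t => AffineMap.lineMap x y (t : ℝ), by fun_prop⟩, by simp, by simp⟩, ?_, ?_⟩
  · intro s t hst
    exact Subtype.ext (AffineMap.lineMap_injective ℝ h hst)
  · rw [segment_eq_image_lineMap]
    ext p
    simp only [Set.mem_range, Set.mem_image]
    exact ⟨fun ⟨t, ht⟩ => ⟨t, t.2, ht⟩, fun ⟨t, ht, h⟩ => ⟨⟨t, ht⟩, h⟩⟩

/-- The initial piece of an arc up to its first point in a disc about the end of the arc. -/
theorem IsArc.exists_initial (h : IsArc x z A) {r : ℝ} (hr : 0 < r) (hx : r < dist x z) :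
    ∃ y B, B ⊆ A ∧ z ∉ B ∧ dist y z = r ∧ IsArc x y B ∧ ∀ p ∈ B, dist p z ≤ r → p = y := by
  obtain ⟨γ, hγ, rfl⟩ := h
  have hc : IsCompact {t | dist (γ t) z ≤ r} :=
    (isClosed_le (by fun_prop) (by fun_prop)).isCompact
  obtain ⟨t, ht, hmin⟩ := hc.exists_isLeast ⟨1, by simp [hr.le]⟩
  have ht0 : t ≠ 0 := by
    rintro rfl
    simp only [Set.mem_ofPred_eq, γ.source] at ht
    linarith
  have hd : dist (γ t) z = r := by
    -- The distance takes the value `r` somewhere up to time `t`; by minimality of `t` this happens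
    -- at `t` itself.
    obtain ⟨s, hs⟩ := mem_range_of_exists_le_of_exists_ge
      (f := fun s : unitInterval => dist (γ (s * t)) z) (c := r) (by fun_prop)
      ⟨1, by simpa using ht⟩ ⟨0, by simpa using hx.le⟩
    have h1 : t ≤ s * t := hmin hs.le
    have h2 : s * t ≤ t := unitInterval.mul_le_right
    rw [h1.antisymm h2]
    exact hs
  have huniq : ∀ p ∈ Set.range (fun s : unitInterval => γ (s * t)), dist p z ≤ r → p = γ t := by
    rintro _ ⟨s, rfl⟩ hs
    exact congrArg γ (unitInterval.mul_le_right.antisymm (hmin hs))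
  refine ⟨γ t, Set.range fun s : unitInterval => γ (s * t), ?_, ?_, hd,
    ⟨⟨⟨fun s => γ (s * t), by fun_prop⟩, by simp, by simp⟩, ?_, rfl⟩, huniq⟩
  · rintro _ ⟨s, rfl⟩
    exact ⟨_, rfl⟩
  · intro hz
    have := huniq z hz (by simp [hr.le])
    rw [← this, dist_self] at hd
    exact hr.ne hd
  · intro s s' hs
    have h1 := congrArg Subtype.val (hγ hs)
    simp only [Set.Icc.coe_mul] at h1
    exact Subtype.ext (mul_right_cancel₀ (fun h => ht0 (Subtype.ext h)) h1)

end Arc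

theorem cos_lt_cos_of_lt_of_lt {h x : ℝ} (h0 : 0 ≤ h) (hx : h < x)
    (hx' : x < 2 * Real.pi - h) : Real.cos x < Real.cos h := by
  rcases le_total x Real.pi with h1 | h1
  · exact Real.cos_lt_cos_of_nonneg_of_le_pi h0 h1 hx
  · rw [← Real.cos_two_pi_sub x]
    exact Real.cos_lt_cos_of_nonneg_of_le_pi h0 (by linarith) (by linarith)

/-- Chords of a circle with non-interleaved ends are disjoint. -/
theorem disjoint_segment_of_lt {o : ℂ} {r a b c d : ℝ} (hr : 0 < r) (hab : a < b) (hbc : b < c)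
    (hcd : c < d) (hda : d < a + 2 * Real.pi) :
    Disjoint
      (segment ℝ (o + r * Complex.exp (a * Complex.I)) (o + r * Complex.exp (b * Complex.I)))
      (segment ℝ (o + r * Complex.exp (c * Complex.I)) (o + r * Complex.exp (d * Complex.I))) := by
  -- The functional `ℓ` is the coordinate in the direction of the midpoint of the circular arc from
  -- `a` to `b`. It is constant on the first chord and strictly smaller at both ends of the second.
  set m := (a + b) / 2 with hm
  set ℓ : ℂ → ℝ := fun z => (z - o).re * Real.cos m + (z - o).im * Real.sin m with hℓ
  have val : ∀ x : ℝ, ℓ (o + r * Complex.exp (x * Complex.I)) = r * Real.cos (x - m) := fun x => by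
    simp only [hℓ, add_sub_cancel_left, Complex.re_ofReal_mul, Complex.im_ofReal_mul,
      Complex.exp_ofReal_mul_I_re, Complex.exp_ofReal_mul_I_im, Real.cos_sub]
    ring
  have lin : ∀ (s t : ℝ) (z w : ℂ), s + t = 1 → ℓ (s • z + t • w) = s * ℓ z + t * ℓ w := by
    intro s t z w h
    obtain rfl : s = 1 - t := by linarith
    simp only [hℓ, Complex.real_smul, Complex.sub_re, Complex.sub_im, Complex.add_re,
      Complex.add_im, Complex.re_ofReal_mul, Complex.im_ofReal_mul]
    ring
  have ea : ℓ (o + r * Complex.exp (a * Complex.I)) = r * Real.cos ((b - a) / 2) := by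
    rw [val, hm, ← Real.cos_neg]; ring_nf
  have eb : ℓ (o + r * Complex.exp (b * Complex.I)) = r * Real.cos ((b - a) / 2) := by
    rw [val, hm]; ring_nf
  have ec : ℓ (o + r * Complex.exp (c * Complex.I)) < r * Real.cos ((b - a) / 2) := by
    rw [val]
    exact mul_lt_mul_of_pos_left
      (cos_lt_cos_of_lt_of_lt (by linarith) (by linarith) (by linarith)) hr
  have ed : ℓ (o + r * Complex.exp (d * Complex.I)) < r * Real.cos ((b - a) / 2) := by
    rw [val]
    exact mul_lt_mul_of_pos_left
      (cos_lt_cos_of_lt_of_lt (by linarith) (by linarith) (by linarith)) hr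
  rw [Set.disjoint_left]
  rintro z ⟨s, t, hs, ht, hst, rfl⟩ ⟨s', t', hs', ht', hst', he⟩
  have h1 := lin s t (o + r * Complex.exp (a * Complex.I)) (o + r * Complex.exp (b * Complex.I)) hst
  rw [← he, lin s' t' _ _ hst', ea, eb] at h1
  rcases hs'.eq_or_lt with rfl | hs'
  · have : t' = 1 := by linarith
    subst this
    rw [← add_mul, hst] at h1
    linarith
  · have h2 := mul_lt_mul_of_pos_left ec hs'
    have h3 := mul_le_mul_of_nonneg_left ed.le ht'
    rw [← add_mul, hst] at h1
    have h4 := add_mul s' t' (r * Real.cos ((b - a) / 2))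
    rw [hst'] at h4
    linarith

namespace SimpleGraph

variable {V : Type*} {G : SimpleGraph V}

namespace PlaneDrawing

/-- The drawing of an induced subgraph. -/
def induce (D : G.PlaneDrawing) (S : Set V) : (G.induce S).PlaneDrawing where
  pos x := D.pos x
  arc e := D.arc ⟨e.1.map Subtype.val, by
    obtain ⟨e, he⟩ := e
    induction e with | _ u w => exact he⟩
  pos_injective := D.pos_injective.comp Subtype.val_injective
  isArc_arc u w h := D.isArc_arc u w h
  mem_of_pos_mem_arc e x h := by
    obtain ⟨y, hy, hyx⟩ := Sym2.mem_map.1 (D.mem_of_pos_mem_arc _ _ h)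
    exact Subtype.ext hyx ▸ hy
  exists_of_mem_arc_of_mem_arc e f hef p he hf := by
    obtain ⟨x, hx, hx', h⟩ := D.exists_of_mem_arc_of_mem_arc _ _
      (fun h => hef (Subtype.ext (Sym2.map.injective Subtype.val_injective
        (congrArg Subtype.val h)))) p he hf
    obtain ⟨y, hy, rfl⟩ := Sym2.mem_map.1 hx
    obtain ⟨y', hy', h'⟩ := Sym2.mem_map.1 hx'
    exact ⟨y, hy, Subtype.ext h' ▸ hy', h⟩

/-- An edge can be added to a drawing along an arc that meets the drawing in its ends only. -/
theorem exists_sup_edge (D : G.PlaneDrawing) {a b : V} {A : Set ℂ}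
    (hA : IsArc (D.pos a) (D.pos b) A) (hpos : ∀ x, D.pos x ∈ A → x = a ∨ x = b)
    (harc : ∀ e, ∀ p ∈ A, p ∈ D.arc e → ∃ x ∈ e.1, (x = a ∨ x = b) ∧ D.pos x = p) :
    ∃ D' : (G ⊔ edge a b).PlaneDrawing, D'.pos = D.pos ∧
      ∀ e, (∃ h, D'.arc e = D.arc ⟨e.1, h⟩) ∨ (e.1 = s(a, b) ∧ D'.arc e = A) := by
  classical
  have hnew : ∀ e : (G ⊔ edge a b).edgeSet, e.1 ∉ G.edgeSet → e.1 = s(a, b) := by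
    rintro ⟨e, he⟩ hG
    induction e with
    | _ u w =>
      rcases he with he | he
      · exact (hG he).elim
      · rw [edge_adj] at he
        simpa using he.1
  refine ⟨{
    pos := D.pos
    -- If `a` and `b` are already adjacent, the old arc is kept.
    arc := fun e => if h : e.1 ∈ G.edgeSet then D.arc ⟨e.1, h⟩ else A
    pos_injective := D.pos_injective
    isArc_arc := ?_
    mem_of_pos_mem_arc := ?_
    exists_of_mem_arc_of_mem_arc := ?_ }, rfl, ?_⟩
  · intro u w h
    by_cases hG : s(u, w) ∈ G.edgeSet
    · simp only [hG, dif_pos]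
      exact D.isArc_arc u w hG
    · simp only [hG, dif_neg, not_false_eq_true]
      rcases Sym2.eq_iff.1 (hnew ⟨s(u, w), h⟩ hG) with ⟨rfl, rfl⟩ | ⟨rfl, rfl⟩
      · exact hA
      · exact hA.symm
  · intro e x hx
    by_cases hG : e.1 ∈ G.edgeSet
    · simp only [hG, dif_pos] at hx
      exact D.mem_of_pos_mem_arc _ _ hx
    · simp only [hG, dif_neg, not_false_eq_true] at hx
      rw [hnew e hG]
      simpa using hpos x hx
  · intro e f hef p he hf
    by_cases hGe : e.1 ∈ G.edgeSet <;> by_cases hGf : f.1 ∈ G.edgeSet <;>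
      simp only [hGe, hGf, dif_pos, dif_neg, not_false_eq_true] at he hf
    · exact D.exists_of_mem_arc_of_mem_arc _ _
        (fun h => hef (Subtype.ext (Subtype.mk.inj h))) p he hf
    · obtain ⟨x, hx, hx', h⟩ := harc _ p hf he
      exact ⟨x, hx, by rw [hnew f hGf]; simpa using hx', h⟩
    · obtain ⟨x, hx, hx', h⟩ := harc _ p he hf
      exact ⟨x, by rw [hnew e hGe]; simpa using hx', hx, h⟩
    · exact (hef (Subtype.ext ((hnew e hGe).trans (hnew f hGf).symm))).elim
  · intro e
    by_cases hG : e.1 ∈ G.edgeSet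
    · exact Or.inl ⟨hG, by simp [hG]⟩
    · exact Or.inr ⟨hnew e hG, by simp [hG]⟩

theorem isClosed_arc (D : G.PlaneDrawing) (e : G.edgeSet) : IsClosed (D.arc e) := by
  obtain ⟨e, he⟩ := e
  induction e with | _ u w => exact (D.isArc_arc u w he).isClosed

end PlaneDrawing

end SimpleGraph

/-! ### The disc about a vertex -/

open SimpleGraph

variable {V : Type*} {G : SimpleGraph V}

/-- A disc about the vertex `v` of a plane graph that meets no vertex other than `v` and no edge
that does not end at `v`, together with, for every neighbor `u` of `v`, the initial piece `stem u`
of the edge from `u` to `v` up to its first point `tip u` in the disc. -/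
structure StarCut (D : G.PlaneDrawing) (v : V) where
  r : ℝ
  tip : V → ℂ
  stem : V → Set ℂ
  r_pos : 0 < r
  lt_dist_pos : ∀ x ≠ v, r < dist (D.pos x) (D.pos v)
  lt_dist_arc : ∀ e : G.edgeSet, v ∉ e.1 → ∀ z ∈ D.arc e, r < dist z (D.pos v)
  isArc_stem : ∀ u, G.Adj v u → IsArc (D.pos u) (tip u) (stem u)
  stem_subset : ∀ u (h : G.Adj v u), stem u ⊆ D.arc ⟨s(u, v), h.symm⟩
  pos_notMem_stem : ∀ u, G.Adj v u → D.pos v ∉ stem u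
  dist_tip : ∀ u, G.Adj v u → dist (tip u) (D.pos v) = r
  eq_tip : ∀ u, G.Adj v u → ∀ z ∈ stem u, dist z (D.pos v) ≤ r → z = tip u

/-- The bound is stated for all small `r`, so that one radius serves finitely many closed sets. -/
theorem exists_pos_lt_dist {S : Set ℂ} (hS : IsClosed S) {o : ℂ} (ho : o ∉ S) :
    ∀ᶠ r in nhdsWithin (0 : ℝ) (Set.Ioi 0), ∀ z ∈ S, r < dist z o := by
  obtain ⟨ε, hε, h⟩ := Metric.isOpen_iff.1 hS.isOpen_compl o ho
  filter_upwards [Ioo_mem_nhdsGT hε] with r hr z hz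
  refine hr.2.trans_le ?_
  by_contra! hlt
  exact h hlt hz

theorem nonempty_starCut [Finite V] (D : G.PlaneDrawing) (v : V) : Nonempty (StarCut D v) := by
  have h1 : ∀ᶠ r in nhdsWithin (0 : ℝ) (Set.Ioi 0),
      ∀ x, x ≠ v → ∀ z ∈ ({D.pos x} : Set ℂ), r < dist z (D.pos v) :=
    Filter.eventually_all.2 fun x => Filter.eventually_imp_distrib_left.2 fun hx =>
      exists_pos_lt_dist isClosed_singleton fun h => hx (D.pos_injective h).symm
  have h2 : ∀ᶠ r in nhdsWithin (0 : ℝ) (Set.Ioi 0),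
      ∀ e : G.edgeSet, v ∉ e.1 → ∀ z ∈ D.arc e, r < dist z (D.pos v) :=
    Filter.eventually_all.2 fun e => Filter.eventually_imp_distrib_left.2 fun he =>
      exists_pos_lt_dist (D.isClosed_arc e) fun h => he (D.mem_of_pos_mem_arc e v h)
  obtain ⟨r, hr1, hr2, hr⟩ := (h1.and (h2.and self_mem_nhdsWithin)).exists
  have h3 : ∀ u, ∃ (y : ℂ) (B : Set ℂ), ∀ h : G.Adj v u, B ⊆ D.arc ⟨s(u, v), h.symm⟩ ∧
      D.pos v ∉ B ∧ dist y (D.pos v) = r ∧ IsArc (D.pos u) y B ∧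
      ∀ p ∈ B, dist p (D.pos v) ≤ r → p = y := by
    intro u
    by_cases h : G.Adj v u
    · obtain ⟨y, B, hB⟩ := (D.isArc_arc u v h.symm).exists_initial hr (hr1 u h.ne' _ rfl)
      exact ⟨y, B, fun _ => hB⟩
    -- Dummy values: nothing is required at non-neighbors.
    · exact ⟨0, ∅, fun h' => (h h').elim⟩
  choose tip stem hstem using h3
  exact ⟨⟨r, tip, stem, hr, fun x hx => hr1 x hx _ rfl, hr2, fun u h => (hstem u h).2.2.2.1,
    fun u h => (hstem u h).1, fun u h => (hstem u h).2.1, fun u h => (hstem u h).2.2.1,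
    fun u h => (hstem u h).2.2.2.2⟩⟩

end

/-! ### Cyclic order of the neighbors -/

section

open SimpleGraph

variable {V : Type*} {G : SimpleGraph V}

namespace StarCut

variable {D : G.PlaneDrawing} {v : V}

/-- The direction in which the edge from `v` to `u` leaves the disc. -/
noncomputable def angle (C : StarCut D v) (u : V) : ℝ := (C.tip u - D.pos v).arg

theorem tip_eq (C : StarCut D v) {u : V} (hu : G.Adj v u) :
    C.tip u = D.pos v + C.r * Complex.exp (C.angle u * Complex.I) := by
  have h := Complex.norm_mul_exp_arg_mul_I (C.tip u - D.pos v)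
  rw [← dist_eq_norm, C.dist_tip u hu] at h
  rw [angle, h]
  ring

/-- Two edges at `v` with different other ends meet only in `v`, which the stems omit. -/
theorem eq_of_mem_stem (C : StarCut D v) {u w : V} (hu : G.Adj v u) (hw : G.Adj v w) {z : ℂ}
    (hzu : z ∈ C.stem u) (hzw : z ∈ C.stem w) : u = w := by
  by_contra hne
  obtain ⟨x, hx, hx', rfl⟩ := D.exists_of_mem_arc_of_mem_arc ⟨s(u, v), hu.symm⟩
    ⟨s(w, v), hw.symm⟩ (fun h => hne (Sym2.congr_left.1 (Subtype.mk.inj h))) z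
    (C.stem_subset u hu hzu) (C.stem_subset w hw hzw)
  have h1 : x = u ∨ x = v := by simpa using hx
  have h2 : x = w ∨ x = v := by simpa using hx'
  have h3 : x = v := by
    rcases h1 with rfl | h1
    · exact h2.resolve_left hne
    · exact h1
  exact C.pos_notMem_stem u hu (h3 ▸ hzu)

theorem tip_mem_stem (C : StarCut D v) {u : V} (hu : G.Adj v u) : C.tip u ∈ C.stem u :=
  (C.isArc_stem u hu).right_mem

theorem eq_of_tip_eq (C : StarCut D v) {u w : V} (hu : G.Adj v u) (hw : G.Adj v w)
    (h : C.tip u = C.tip w) : u = w :=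
  C.eq_of_mem_stem hu hw (C.tip_mem_stem hu) (h ▸ C.tip_mem_stem hw)

theorem eq_of_angle_eq (C : StarCut D v) {u w : V} (hu : G.Adj v u) (hw : G.Adj v w)
    (h : C.angle u = C.angle w) : u = w :=
  C.eq_of_tip_eq hu hw (by rw [C.tip_eq hu, C.tip_eq hw, h])

theorem eq_of_pos_mem_stem (C : StarCut D v) {u x : V} (hu : G.Adj v u)
    (h : D.pos x ∈ C.stem u) : x = u := by
  have h1 := D.mem_of_pos_mem_arc _ _ (C.stem_subset u hu h)
  have h2 : x = u ∨ x = v := by simpa using h1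
  rcases h2 with h2 | rfl
  · exact h2
  · exact (C.pos_notMem_stem u hu h).elim

theorem segment_subset (C : StarCut D v) {a b : V} (ha : G.Adj v a) (hb : G.Adj v b) {z : ℂ}
    (hz : z ∈ segment ℝ (C.tip a) (C.tip b)) : dist z (D.pos v) ≤ C.r :=
  (convex_closedBall (D.pos v) C.r).segment_subset (C.dist_tip a ha).le (C.dist_tip b hb).le hz

/-- An arc from `a` to `b` close to the edges from `a` and `b` to `v`, through a chord of
the disc. -/
def chordArc (C : StarCut D v) (a b : V) : Set ℂ :=
  C.stem a ∪ (segment ℝ (C.tip a) (C.tip b) ∪ C.stem b)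

theorem isArc_chordArc (C : StarCut D v) {a b : V} (ha : G.Adj v a) (hb : G.Adj v b)
    (hab : a ≠ b) : IsArc (D.pos a) (D.pos b) (C.chordArc a b) := by
  refine (C.isArc_stem a ha).trans ((isArc_segment fun h => hab (C.eq_of_tip_eq ha hb h)).trans
    (C.isArc_stem b hb).symm fun p hp hpb => C.eq_tip b hb p hpb (C.segment_subset ha hb hp)) ?_
  rintro p hpa (hp | hp)
  · exact C.eq_tip a ha p hpa (C.segment_subset ha hb hp)
  · exact (hab (C.eq_of_mem_stem ha hb hpa hp)).elim

theorem eq_of_pos_mem_chordArc (C : StarCut D v) {a b x : V} (ha : G.Adj v a) (hb : G.Adj v b)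
    (hx : x ≠ v) (h : D.pos x ∈ C.chordArc a b) : x = a ∨ x = b := by
  rcases h with h | h | h
  · exact Or.inl (C.eq_of_pos_mem_stem ha h)
  · exact ((C.lt_dist_pos x hx).not_ge (C.segment_subset ha hb h)).elim
  · exact Or.inr (C.eq_of_pos_mem_stem hb h)

theorem exists_of_mem_stem_of_mem_arc (C : StarCut D v) {a : V} (ha : G.Adj v a) {e : G.edgeSet}
    (he : v ∉ e.1) {p : ℂ} (hp : p ∈ C.stem a) (hpe : p ∈ D.arc e) : a ∈ e.1 ∧ D.pos a = p := by
  obtain ⟨x, hx, hx', rfl⟩ := D.exists_of_mem_arc_of_mem_arc e ⟨s(a, v), ha.symm⟩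
    (fun h => he (h ▸ Sym2.mem_mk_right a v)) p hpe (C.stem_subset a ha hp)
  obtain rfl := C.eq_of_pos_mem_stem ha hp
  exact ⟨hx, rfl⟩

theorem exists_of_mem_chordArc_of_mem_arc (C : StarCut D v) {a b : V} (ha : G.Adj v a)
    (hb : G.Adj v b) {e : G.edgeSet} (he : v ∉ e.1) {p : ℂ} (hp : p ∈ C.chordArc a b)
    (hpe : p ∈ D.arc e) : ∃ x ∈ e.1, (x = a ∨ x = b) ∧ D.pos x = p := by
  rcases hp with h | h | h
  · obtain ⟨h1, h2⟩ := C.exists_of_mem_stem_of_mem_arc ha he h hpe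
    exact ⟨a, h1, Or.inl rfl, h2⟩
  · exact ((C.lt_dist_arc e he p hpe).not_ge (C.segment_subset ha hb h)).elim
  · obtain ⟨h1, h2⟩ := C.exists_of_mem_stem_of_mem_arc hb he h hpe
    exact ⟨b, h1, Or.inr rfl, h2⟩

/-- A stem meets the disc only in its tip, an end of its chord, so a common point of a stem and a
chord would be common to both chords. -/
theorem disjoint_chordArc (C : StarCut D v) {a b c d : V} (ha : G.Adj v a) (hb : G.Adj v b)
    (hc : G.Adj v c) (hd : G.Adj v d) (hac : a ≠ c) (had : a ≠ d) (hbc : b ≠ c) (hbd : b ≠ d)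
    (h : Disjoint (segment ℝ (C.tip a) (C.tip b)) (segment ℝ (C.tip c) (C.tip d))) :
    Disjoint (C.chordArc a b) (C.chordArc c d) := by
  rw [Set.disjoint_left] at h ⊢
  rintro p (hp | hp | hp) (hq | hq | hq)
  · exact hac (C.eq_of_mem_stem ha hc hp hq)
  · rw [C.eq_tip a ha p hp (C.segment_subset hc hd hq)] at hq
    exact h (left_mem_segment ℝ _ _) hq
  · exact had (C.eq_of_mem_stem ha hd hp hq)
  · rw [C.eq_tip c hc p hq (C.segment_subset ha hb hp)] at hp
    exact h hp (left_mem_segment ℝ _ _)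
  · exact h hp hq
  · rw [C.eq_tip d hd p hq (C.segment_subset ha hb hp)] at hp
    exact h hp (right_mem_segment ℝ _ _)
  · exact hbc (C.eq_of_mem_stem hb hc hp hq)
  · rw [C.eq_tip b hb p hp (C.segment_subset hc hd hq)] at hq
    exact h (right_mem_segment ℝ _ _) hq
  · exact hbd (C.eq_of_mem_stem hb hd hp hq)

/-- Two pairs of neighbors of `v` whose chords are disjoint are non-overlapping. -/
theorem nonOverlapping (C : StarCut D v) {a b c d : ({v}ᶜ : Set V)} (ha : G.Adj v a)
    (hb : G.Adj v b) (hc : G.Adj v c) (hd : G.Adj v d) (hn : [a, b, c, d].Nodup)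
    (h : Disjoint (segment ℝ (C.tip a) (C.tip b)) (segment ℝ (C.tip c) (C.tip d))) :
    G.NonOverlapping v a b c d := by
  obtain ⟨⟨hab, hac, had⟩, ⟨hbc, hbd⟩, hcd⟩ :
      (a ≠ b ∧ a ≠ c ∧ a ≠ d) ∧ (b ≠ c ∧ b ≠ d) ∧ c ≠ d := by simpa using hn
  have hne : ∀ {x y : ({v}ᶜ : Set V)}, x ≠ y → (x : V) ≠ y := fun h h' => h (Subtype.ext h')
  have hdisj := Set.disjoint_left.1 (C.disjoint_chordArc ha hb hc hd (hne hac) (hne had) (hne hbc)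
    (hne hbd) h)
  have hold : ∀ {x y : ({v}ᶜ : Set V)}, G.Adj v x → G.Adj v y →
      ∀ (e : (G.induce {v}ᶜ).edgeSet), ∀ p ∈ C.chordArc x y, p ∈ (D.induce {v}ᶜ).arc e →
        ∃ z ∈ e.1, (z = x ∨ z = y) ∧ (D.induce {v}ᶜ).pos z = p := by
    intro x y hx hy e p hp hpe
    obtain ⟨z, hz, hz', rfl⟩ := C.exists_of_mem_chordArc_of_mem_arc hx hy
      (e := ⟨e.1.map Subtype.val, _⟩) (fun hv => by
        obtain ⟨u, -, hu⟩ := Sym2.mem_map.1 hv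
        exact u.2 hu) hp hpe
    obtain ⟨w, hw, rfl⟩ := Sym2.mem_map.1 hz
    exact ⟨w, hw, hz'.imp Subtype.ext Subtype.ext, rfl⟩
  obtain ⟨D₁, hpos, harc⟩ := (D.induce {v}ᶜ).exists_sup_edge
    (C.isArc_chordArc ha hb (hne hab))
    (fun x hx => (C.eq_of_pos_mem_chordArc ha hb x.2 hx).imp Subtype.ext Subtype.ext)
    (hold ha hb)
  obtain ⟨D₂, -, -⟩ := D₁.exists_sup_edge (a := c) (b := d) (A := C.chordArc c d)
    (by rw [hpos]; exact C.isArc_chordArc hc hd (hne hcd))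
    (fun x hx => by
      rw [hpos] at hx
      exact (C.eq_of_pos_mem_chordArc hc hd x.2 hx).imp Subtype.ext Subtype.ext)
    (fun e p hp hpe => by
      rw [hpos]
      rcases harc e with ⟨h, he⟩ | ⟨-, he⟩
      · exact hold hc hd ⟨e.1, h⟩ p hp (he ▸ hpe)
      · exact (hdisj (he ▸ hpe) hp).elim)
  exact ⟨D₂⟩

/-- The part outside the disc of the drawing of the subgraph induced by `S` and of the edges
from `S` to `v`. -/
def region (C : StarCut D v) (S : Set V) : Set ℂ :=
  {z | C.r ≤ dist z (D.pos v) ∧ ((∃ u ∈ S, z = D.pos u) ∨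
    ∃ e : G.edgeSet, z ∈ D.arc e ∧ (∀ x ∈ e.1, x ∈ S ∨ x = v) ∧ ∃ x ∈ e.1, x ∈ S)}

/-- Edges reaching `v` from `S` and from `T` share `v`, but the disc around it has been removed. -/
theorem disjoint_region (C : StarCut D v) {S T : Set V} (hST : Disjoint S T) (hS : v ∉ S)
    (hT : v ∉ T) : Disjoint (C.region S) (C.region T) := by
  rw [Set.disjoint_left] at hST ⊢
  have hmix : ∀ {S T : Set V}, (∀ {x}, x ∈ S → x ∉ T) → v ∉ S → ∀ {e : G.edgeSet},
      (∀ x ∈ e.1, x ∈ T ∨ x = v) → ∀ u ∈ S, D.pos u ∉ D.arc e := by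
    intro S T hST hS e he u hu hue
    rcases he u (D.mem_of_pos_mem_arc e u hue) with h | rfl
    · exact hST hu h
    · exact hS hu
  rintro z ⟨hr, hzS⟩ ⟨-, hzT⟩
  rcases hzS with ⟨u, hu, rfl⟩ | ⟨e, hze, he, x, hxe, hxS⟩ <;>
    rcases hzT with ⟨w, hw, hwz⟩ | ⟨f, hzf, hf, y, hyf, hyT⟩
  · exact hST hu (D.pos_injective hwz ▸ hw)
  · exact hmix (fun h => hST h) hS hf u hu hzf
  · exact hmix (fun hT hS => hST hS hT) hT he w hw (hwz ▸ hze)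
  · by_cases hef : e = f
    · rcases hf x (hef ▸ hxe) with h | rfl
      · exact hST hxS h
      · exact hS hxS
    · obtain ⟨t, hte, htf, rfl⟩ := D.exists_of_mem_arc_of_mem_arc e f hef z hze hzf
      have htv : t ≠ v := by
        rintro rfl
        rw [_root_.dist_self] at hr
        exact C.r_pos.not_ge hr
      exact hST ((he t hte).resolve_right htv) ((hf t htf).resolve_right htv)

theorem stem_subset_region (C : StarCut D v) {S : Set V} {u : V} (hu : G.Adj v u) (huS : u ∈ S) :
    C.stem u ⊆ C.region S := by
  refine fun z hz => ⟨?_, Or.inr ⟨_, C.stem_subset u hu hz, ?_, u, Sym2.mem_mk_left u v, huS⟩⟩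
  · by_contra! h
    have h1 := C.dist_tip u hu
    rw [← C.eq_tip u hu z hz h.le] at h1
    exact h.ne h1
  · intro x hx
    have h2 : x = u ∨ x = v := by simpa using hx
    exact h2.imp_left fun h => by rwa [h]

theorem joinedIn_region_of_walk (C : StarCut D v) {S : Set V} (hS : v ∉ S) {u w : V}
    (p : G.Walk u w) (hp : ∀ x ∈ p.support, x ∈ S) :
    JoinedIn (C.region S) (D.pos u) (D.pos w) := by
  induction p with
  | @nil u =>
    have huS : u ∈ S := hp u (by simp)
    exact JoinedIn.refl ⟨(C.lt_dist_pos u fun h => hS (h ▸ huS)).le, Or.inl ⟨u, huS, rfl⟩⟩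
  | @cons u x w h p ih =>
    have huS : u ∈ S := hp u (by simp)
    have hxS : x ∈ S := hp x (by simp)
    refine JoinedIn.trans ?_ (ih fun y hy => hp y (by simp [hy]))
    refine (D.isArc_arc u x h).joinedIn.mono fun z hz => ⟨?_, Or.inr ⟨_, hz, ?_, u, by simp, huS⟩⟩
    · refine (C.lt_dist_arc _ (fun hv => hS ?_) z hz).le
      have : v = u ∨ v = x := by simpa using hv
      rcases this with rfl | rfl <;> assumption
    · intro y hy
      have : y = u ∨ y = x := by simpa using hy
      rcases this with rfl | rfl <;> exact Or.inl (by assumption)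

theorem joinedIn_region (C : StarCut D v) {S : Set V} (hS : v ∉ S) {u w : V} (hu : G.Adj v u)
    (hw : G.Adj v w) (p : G.Walk u w) (hp : ∀ x ∈ p.support, x ∈ S) :
    JoinedIn (C.region S) (C.tip u) (C.tip w) :=
  (((C.isArc_stem u hu).joinedIn.mono (C.stem_subset_region hu (hp u (by simp)))).symm.trans
    (C.joinedIn_region_of_walk hS p hp)).trans
    ((C.isArc_stem w hw).joinedIn.mono (C.stem_subset_region hw (hp w (by simp))))

theorem angle_lt_add_two_pi (C : StarCut D v) (u w : V) :
    C.angle u < C.angle w + 2 * Real.pi := by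
  have h1 := Complex.arg_le_pi (C.tip u - D.pos v)
  have h2 := Complex.neg_pi_lt_arg (C.tip w - D.pos v)
  simp only [angle]
  linarith

end StarCut

/-- The vertices `nb 0, …, nb 5` are neighbors of `v` in the cyclic order of some drawing
of `G`. -/
structure IsCyclicNeighbors (G : SimpleGraph V) (v : V) (nb : Fin 6 → V) : Prop where
  adj : ∀ i, G.Adj v (nb i)
  injective : Function.Injective nb
  nonOverlapping : ∀ ⦃i j k l⦄, i < j → j < k → k < l → G.NonOverlapping v
    ⟨nb i, (adj i).ne'⟩ ⟨nb j, (adj j).ne'⟩ ⟨nb k, (adj k).ne'⟩ ⟨nb l, (adj l).ne'⟩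
  nonOverlapping_nested : ∀ ⦃i j k l⦄, i < j → j < k → k < l → G.NonOverlapping v
    ⟨nb i, (adj i).ne'⟩ ⟨nb l, (adj l).ne'⟩ ⟨nb j, (adj j).ne'⟩ ⟨nb k, (adj k).ne'⟩
  not_walk_of_walk : ∀ ⦃i j k l⦄, i < j → j < k → k < l → ∀ ⦃S T : Set V⦄, Disjoint S T →
    v ∉ S → v ∉ T → ∀ p : G.Walk (nb i) (nb k), (∀ x ∈ p.support, x ∈ S) →
    ∀ q : G.Walk (nb j) (nb l), ¬ ∀ x ∈ q.support, x ∈ T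

theorem exists_isCyclicNeighbors [Fintype V] [DecidableRel G.Adj] (D : G.PlaneDrawing) {v : V}
    (hv : G.degree v = 6) : ∃ nb, IsCyclicNeighbors G v nb := by
  obtain ⟨C⟩ := nonempty_starCut D v
  have hcard : ((G.neighborFinset v).image C.angle).card = 6 := by
    rw [Finset.card_image_of_injOn, card_neighborFinset_eq_degree, hv]
    intro u hu w hw h
    exact C.eq_of_angle_eq (by simpa using hu) (by simpa using hw) h
  have hex : ∀ i : Fin 6, ∃ u, G.Adj v u ∧
      C.angle u = ((G.neighborFinset v).image C.angle).orderEmbOfFin hcard i := fun i => by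
    simpa using Finset.mem_image.1 (Finset.orderEmbOfFin_mem _ hcard i)
  choose nb hadj hangle using hex
  have hmono : ∀ {i j}, i < j → C.angle (nb i) < C.angle (nb j) := fun {i j} h => by
    rw [hangle, hangle]
    exact (OrderEmbedding.lt_iff_lt _).2 h
  have hinj : Function.Injective nb := fun i j h => by
    rcases lt_trichotomy i j with h1 | h1 | h1
    · exact ((hmono h1).ne (by rw [h])).elim
    · exact h1
    · exact ((hmono h1).ne (by rw [h])).elim
  have hinj' : Function.Injective fun i => (⟨nb i, (hadj i).ne'⟩ : ({v}ᶜ : Set V)) :=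
    fun i j h => hinj (congrArg Subtype.val h)
  refine ⟨nb, hadj, hinj, fun i j k l hij hjk hkl => ?_, fun i j k l hij hjk hkl => ?_,
    fun i j k l hij hjk hkl S T hST hS hT p hp q hq => ?_⟩
  · refine C.nonOverlapping (hadj i) (hadj j) (hadj k) (hadj l) ?_ ?_
    · exact List.Nodup.map (l := [i, j, k, l]) hinj' (by
        simp [hij.ne, hjk.ne, hkl.ne, (hij.trans hjk).ne, (hjk.trans hkl).ne,
          (hij.trans (hjk.trans hkl)).ne])
    · simp only [C.tip_eq (hadj _)]
      exact disjoint_segment_of_lt C.r_pos (hmono hij) (hmono hjk) (hmono hkl)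
        (C.angle_lt_add_two_pi _ _)
  · refine C.nonOverlapping (hadj i) (hadj l) (hadj j) (hadj k) ?_ ?_
    · exact List.Nodup.map (l := [i, l, j, k]) hinj' (by
        simp [hij.ne, hjk.ne, hkl.ne', (hij.trans hjk).ne, (hjk.trans hkl).ne',
          (hij.trans (hjk.trans hkl)).ne])
    -- One full turn is added to the angle of `nb i`, so that the nested pairs become consecutive in
    -- the order `j, k, l, i`.
    · have h := disjoint_segment_of_lt (o := D.pos v) C.r_pos (hmono hjk) (hmono hkl)
        (C.angle_lt_add_two_pi (nb l) (nb i))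
        (by linarith [hmono hij] : C.angle (nb i) + 2 * Real.pi < C.angle (nb j) + 2 * Real.pi)
      have e : Complex.exp (((C.angle (nb i) + 2 * Real.pi : ℝ) : ℂ) * Complex.I)
          = Complex.exp (C.angle (nb i) * Complex.I) := by
        push_cast
        rw [add_mul, Complex.exp_periodic]
      simp only [C.tip_eq (hadj _)]
      rw [segment_symm]
      rw [e] at h
      exact h.symm
  · refine not_joinedIn_of_interleaved C.r_pos (hmono hij) (hmono hjk) (hmono hkl)
      (C.angle_lt_add_two_pi _ _) (C.disjoint_region hST hS hT) (fun z hz => hz.1)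
      (fun z hz => hz.1) ?_ ?_
    · rw [← C.tip_eq (hadj i), ← C.tip_eq (hadj k)]
      exact C.joinedIn_region hS (hadj i) (hadj k) p hp
    · rw [← C.tip_eq (hadj j), ← C.tip_eq (hadj l)]
      exact C.joinedIn_region hT (hadj j) (hadj l) q hq

end

/-! ### Kempe chains around a vertex -/

section

open SimpleGraph

variable {V : Type*} {G : SimpleGraph V} {k : ℕ}

/-- `u` and `w` are joined by a walk all of whose vertices have color `a` or `b`. -/
def SimpleGraph.Coloring.Linked (φ : G.Coloring (Fin k)) (a b : Fin k) (u w : V) : Prop :=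
  ∃ p : G.Walk u w, ∀ x ∈ p.support, φ x = a ∨ φ x = b

namespace SimpleGraph.Coloring

theorem Linked.symm {φ : G.Coloring (Fin k)} {a b : Fin k} {u w : V} (h : φ.Linked a b u w) :
    φ.Linked a b w u := by
  obtain ⟨p, hp⟩ := h
  exact ⟨p.reverse, fun x hx => hp x (by simpa using hx)⟩

theorem Linked.trans {φ : G.Coloring (Fin k)} {a b : Fin k} {u w x : V}
    (h : φ.Linked a b u w) (h' : φ.Linked a b w x) : φ.Linked a b u x := by
  obtain ⟨p, hp⟩ := h
  obtain ⟨q, hq⟩ := h'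
  exact ⟨p.append q, fun y hy => ((p.mem_support_append_iff q).1 hy).elim (hp y) (hq y)⟩

theorem isKempeChain_setOf_linked (φ : G.Coloring (Fin k)) {a b : Fin k} {u : V}
    (hu : φ u = a ∨ φ u = b) : φ.IsKempeChain a b {w | φ.Linked a b u w} := by
  refine ⟨(G.induce {w | φ w = a ∨ φ w = b}).connectedComponentMk ⟨u, hu⟩, ?_⟩
  ext w
  constructor
  · rintro ⟨p, hp⟩
    exact ⟨⟨w, hp w p.end_mem_support⟩,
      ConnectedComponent.sound (p.induce _ hp).reachable.symm, rfl⟩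
  · rintro ⟨w, hw, rfl⟩
    obtain ⟨p⟩ := (ConnectedComponent.exact hw).symm
    refine ⟨p.map (Embedding.induce _).toHom, fun x hx => ?_⟩
    obtain ⟨y, -, rfl⟩ := List.mem_map.1 (p.support_map _ ▸ hx)
    exact y.2

theorem KempeReachableAvoiding.trans {c : Fin k} {m n : ℕ} {φ ψ χ : G.Coloring (Fin k)}
    (h : KempeReachableAvoiding c m φ ψ) (h' : KempeReachableAvoiding c n ψ χ) :
    KempeReachableAvoiding c (m + n) φ χ := by
  obtain ⟨γ, h0, hm, hγ⟩ := h
  obtain ⟨δ, h0', hn, hδ⟩ := h'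
  have hval : ∀ i, (fun i => if i < m then γ i else δ (i - m)) (m + i) = δ i := fun i => by simp
  have hval' : ∀ i ≤ m, (fun i => if i < m then γ i else δ (i - m)) i = γ i := fun i hi => by
    rcases hi.lt_or_eq with hi | rfl
    · simp [hi]
    · simp [h0', hm]
  refine ⟨fun i => if i < m then γ i else δ (i - m), (hval' 0 m.zero_le).trans h0,
    (hval n).trans hn, fun i hi => ?_⟩
  rcases lt_or_ge i m with him | him
  · rw [hval' i him.le, hval' (i + 1) him]
    exact hγ i him
  · obtain ⟨j, rfl⟩ := Nat.exists_eq_add_of_le him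
    rw [hval j, add_assoc, hval (j + 1)]
    exact hδ j (by omega)

/-- Swapping the colors `a` and `b` on the Kempe chain of a vertex `u` of color `a`. -/
theorem exists_kempeReachableAvoiding_one (φ : G.Coloring (Fin k)) {a b c : Fin k} {u : V}
    (hab : a ≠ b) (hac : a ≠ c) (hbc : b ≠ c) (hu : φ u = a) :
    ∃ ψ : G.Coloring (Fin k), KempeReachableAvoiding c 1 φ ψ ∧ ψ u = b ∧
      (∀ w, φ w ≠ a → φ w ≠ b → ψ w = φ w) ∧ (∀ w, φ w = a → φ.Linked a b u w → ψ w = b) ∧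
      (∀ w, φ w = b → φ.Linked a b u w → ψ w = a) ∧ ∀ w, ¬ φ.Linked a b u w → ψ w = φ w := by
  classical
  have hcol : ∀ {w}, φ.Linked a b u w → φ w = a ∨ φ w = b := fun ⟨p, hp⟩ =>
    hp _ p.end_mem_support
  have hself : φ.Linked a b u u := ⟨Walk.nil, by simp [hu]⟩
  have hadj : ∀ {w x}, G.Adj w x → φ.Linked a b u w → (φ x = a ∨ φ x = b) →
      φ.Linked a b u x := fun {w x} h hw hx =>
    hw.trans ⟨h.toWalk, fun y hy => by
      have hy' : y = w ∨ y = x := by simpa using hy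
      rcases hy' with rfl | rfl
      · exact hcol hw
      · exact hx⟩
  -- By maximality of the chain, a vertex outside it with a neighbor in it has neither color, so the
  -- swap stays proper.
  have hmix : ∀ {w x}, G.Adj w x → φ.Linked a b u w → ¬ φ.Linked a b u x →
      Equiv.swap a b (φ w) ≠ φ x := by
    intro w x h hw hx he
    refine hx (hadj h hw ?_)
    rcases hcol hw with h1 | h1 <;> simp [h1] at he <;> simp [← he]
  let ψ : G.Coloring (Fin k) := Coloring.mk
    (fun w => if φ.Linked a b u w then Equiv.swap a b (φ w) else φ w) (by
      intro w x h
      by_cases hw : φ.Linked a b u w <;> by_cases hx : φ.Linked a b u x <;>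
        simp only [hw, hx, if_true, if_false]
      · exact fun he => φ.valid h ((Equiv.swap a b).injective he)
      · exact hmix h hw hx
      · exact (hmix h.symm hx hw).symm
      · exact φ.valid h)
  have hpos : ∀ w, φ.Linked a b u w → ψ w = Equiv.swap a b (φ w) := fun w hw => if_pos hw
  have hneg : ∀ w, ¬ φ.Linked a b u w → ψ w = φ w := fun w hw => if_neg hw
  refine ⟨ψ, ⟨fun i => if i = 0 then φ else ψ, rfl, rfl, fun i hi => ?_⟩,
    by simp [hpos u hself, hu], fun w h1 h2 => hneg w fun h => (hcol h).elim h1 h2,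
    fun w h1 h2 => by simp [hpos w h2, h1], fun w h1 h2 => by simp [hpos w h2, h1], hneg⟩
  obtain rfl : i = 0 := by omega
  refine ⟨⟨a, b, _, hab, isKempeChain_setOf_linked φ (Or.inl hu), hpos, hneg⟩, fun w hw => ?_⟩
  change ψ w ≠ φ w at hw
  change ψ w ≠ c
  by_cases hl : φ.Linked a b u w
  · rw [hpos w hl]
    rcases hcol hl with h | h <;> simp [h, hac, hbc]
  · exact (hw (hneg w hl)).elim

end SimpleGraph.Coloring

open SimpleGraph.Coloring

theorem SimpleGraph.NonOverlapping.swap {v : V} {a b c d : ({v}ᶜ : Set V)}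
    (h : G.NonOverlapping v a b c d) : G.NonOverlapping v c d a b := by
  unfold NonOverlapping at *
  rwa [sup_right_comm]

theorem SimpleGraph.NonOverlapping.swap_right {v : V} {a b c d : ({v}ᶜ : Set V)}
    (h : G.NonOverlapping v a b c d) : G.NonOverlapping v a b d c := by
  unfold NonOverlapping at *
  rwa [edge_comm d c]

theorem SimpleGraph.NonOverlapping.swap_left {v : V} {a b c d : ({v}ᶜ : Set V)}
    (h : G.NonOverlapping v a b c d) : G.NonOverlapping v b a c d :=
  h.swap.swap_right.swap

namespace IsCyclicNeighbors

variable {v : V} {nb : Fin 6 → V}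

theorem lt_add_one_or (l : Fin 6) : (l = 5 ∧ l + 1 = 0) ∨ l < l + 1 ∧ l < 5 := by
  revert l; decide

theorem add_one_lt {i j : Fin 6} (h : i < j) (hj : j < 5) : i + 1 < j + 1 := by
  revert i j; decide

theorem zero_lt_add_one {i j : Fin 6} (h : i < j) : 0 < i + 1 := by
  revert i j; decide

/-- When the last index wraps round to `0`, consecutive and nested pairs change places, and the two
walks exchange roles. -/
theorem rotate_one (h : IsCyclicNeighbors G v nb) :
    IsCyclicNeighbors G v (fun i => nb (i + 1)) := by
  have key : ∀ {i j k l : Fin 6}, i < j → j < k → k < l →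
      i + 1 < j + 1 ∧ j + 1 < k + 1 ∧
        ((l < 5 ∧ k + 1 < l + 1) ∨ (l + 1 = 0 ∧ 0 < i + 1)) := by
    intro i j k l hij hjk hkl
    have hk : k < 5 := hkl.trans_le (Fin.le_last l)
    refine ⟨add_one_lt hij (hjk.trans hk), add_one_lt hjk hk, ?_⟩
    rcases lt_add_one_or l with hl | hl
    · exact Or.inr ⟨hl.2, zero_lt_add_one hij⟩
    · exact Or.inl ⟨hl.2, add_one_lt hkl hl.2⟩
  refine ⟨fun i => h.adj _, fun i j hij => add_left_injective 1 (h.injective hij),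
    fun i j k l hij hjk hkl => ?_, fun i j k l hij hjk hkl => ?_,
    fun i j k l hij hjk hkl S T hST hS hT p hp q hq => ?_⟩ <;>
    obtain ⟨h1, h2, ⟨-, h3⟩ | ⟨h3, h4⟩⟩ := key hij hjk hkl
  · exact h.nonOverlapping h1 h2 h3
  · exact (h.nonOverlapping_nested (h3 ▸ h4) h1 h2).swap.swap_right
  · exact h.nonOverlapping_nested h1 h2 h3
  · exact (h.nonOverlapping (h3 ▸ h4) h1 h2).swap_left
  · exact h.not_walk_of_walk h1 h2 h3 hST hS hT p hp q hq
  · exact h.not_walk_of_walk (h3 ▸ h4) h1 h2 hST.symm hT hS q.reverse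
      (fun x hx => hq x (by simpa using hx)) p hp

theorem rotate (h : IsCyclicNeighbors G v nb) (s : Fin 6) :
    IsCyclicNeighbors G v (fun i => nb (i + s)) := by
  induction s using Fin.induction with
  | zero => simpa using h
  | succ s ih =>
    rw [← Fin.coeSucc_eq_succ]
    simpa [add_assoc, add_comm, add_left_comm] using ih.rotate_one

variable {q : ℕ} {φ : G.Coloring (Fin q)}

theorem isGood_of_three (h : IsCyclicNeighbors G v nb) {i j k : Fin 6} (hij : i ≠ j)
    (hik : i ≠ k) (hjk : j ≠ k) (h1 : φ (nb i) = φ (nb j)) (h2 : φ (nb j) = φ (nb k)) :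
    φ.IsGood v :=
  Or.inl ⟨nb i, nb j, nb k, h.adj i, h.adj j, h.adj k, h.injective.ne hij, h.injective.ne hik,
    h.injective.ne hjk, h1, h2⟩

theorem isGood_of_pairs (h : IsCyclicNeighbors G v nb) {i j k l : Fin 6} (hij : i < j)
    (hjk : j < k) (hkl : k < l) (h1 : φ (nb i) = φ (nb j)) (h2 : φ (nb k) = φ (nb l)) :
    φ.IsGood v := by
  have hinj : Function.Injective fun i => (⟨nb i, (h.adj i).ne'⟩ : ({v}ᶜ : Set V)) :=
    fun i j e => h.injective (congrArg Subtype.val e)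
  refine Or.inr ⟨_, _, _, _, h.adj i, h.adj j, h.adj k, h.adj l,
    List.Nodup.map (l := [i, j, k, l]) hinj ?_, h1, h2, h.nonOverlapping hij hjk hkl⟩
  simp [hij.ne, hjk.ne, hkl.ne, (hij.trans hjk).ne, (hjk.trans hkl).ne,
    (hij.trans (hjk.trans hkl)).ne]

theorem isGood_of_nested (h : IsCyclicNeighbors G v nb) {i j k l : Fin 6} (hij : i < j)
    (hjk : j < k) (hkl : k < l) (h1 : φ (nb i) = φ (nb l)) (h2 : φ (nb j) = φ (nb k)) :
    φ.IsGood v := by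
  have hinj : Function.Injective fun i => (⟨nb i, (h.adj i).ne'⟩ : ({v}ᶜ : Set V)) :=
    fun i j e => h.injective (congrArg Subtype.val e)
  refine Or.inr ⟨_, _, _, _, h.adj i, h.adj l, h.adj j, h.adj k,
    List.Nodup.map (l := [i, l, j, k]) hinj ?_, h1, h2, h.nonOverlapping_nested hij hjk hkl⟩
  simp [hij.ne, hjk.ne, hkl.ne', (hij.trans hjk).ne, (hjk.trans hkl).ne',
    (hij.trans (hjk.trans hkl)).ne]

/-- The two color classes are disjoint and miss `v`, so `not_walk_of_walk` applies to them. -/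
theorem not_linked_of_linked (h : IsCyclicNeighbors G v nb) {a b c d : Fin q}
    (hn : a ≠ c ∧ a ≠ d ∧ b ≠ c ∧ b ≠ d) (hv : a ≠ φ v ∧ b ≠ φ v ∧ c ≠ φ v ∧ d ≠ φ v)
    {i j k l : Fin 6} (hij : i < j) (hjk : j < k) (hkl : k < l)
    (h1 : φ.Linked a b (nb i) (nb k)) : ¬ φ.Linked c d (nb j) (nb l) := by
  obtain ⟨p, hp⟩ := h1
  rintro ⟨q, hq⟩
  refine h.not_walk_of_walk hij hjk hkl (S := {x | φ x = a ∨ φ x = b})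
    (T := {x | φ x = c ∨ φ x = d}) (Set.disjoint_left.2 ?_) ?_ ?_ p hp q hq
  · rintro x (h1 | h1) (h2 | h2) <;> simp_all
  · rintro (h1 | h1) <;> simp_all
  · rintro (h1 | h1) <;> simp_all

end IsCyclicNeighbors

end

/-! ### Color patterns around a vertex of degree six -/

section

open SimpleGraph SimpleGraph.Coloring

variable {V : Type*} {G : SimpleGraph V} {q : ℕ}

namespace IsCyclicNeighbors

variable {v : V} {nb : Fin 6 → V} {φ : G.Coloring (Fin q)} {x y z w : Fin q}

/-- Neighbors colored `x ? x z y w` in cyclic order, with an arbitrary second color. -/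
theorem exists_isGood_of_xxzyw (h : IsCyclicNeighbors G v nb) (hn : [x, y, z, w, φ v].Nodup)
    (h0 : φ (nb 0) = x) (h2 : φ (nb 2) = x) (h3 : φ (nb 3) = z)
    (h4 : φ (nb 4) = y) (h5 : φ (nb 5) = w) :
    ∃ ψ, KempeReachableAvoiding (φ v) 1 φ ψ ∧ ψ.IsGood v := by
  obtain ⟨⟨hxy, hxz, hxw, hxv⟩, ⟨hyz, hyw, hyv⟩, ⟨hzw, hzv⟩, hwv⟩ :
    (x ≠ y ∧ x ≠ z ∧ x ≠ w ∧ x ≠ φ v) ∧ (y ≠ z ∧ y ≠ w ∧ y ≠ φ v) ∧ (z ≠ w ∧ z ≠ φ v) ∧ w ≠ φ v :=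
    by simpa using hn
  by_cases hl : φ.Linked z w (nb 3) (nb 5)
  -- The `z`-`w` chain cuts neighbor 4 off from 0 and 2: recoloring 4 gives three neighbors of color
  -- `x`.
  · obtain ⟨ψ, hψ, hu, ho, ha, hb, hc⟩ := φ.exists_kempeReachableAvoiding_one hxy.symm hyv hxv h4
    have e0 := hc (nb 0) fun h' => h.not_linked_of_linked (by grind) (by grind)
      (show (0 : Fin 6) < 3 by decide) (show (3 : Fin 6) < 4 by decide)
      (show (4 : Fin 6) < 5 by decide) h'.symm hl
    have e2 := hc (nb 2) fun h' => h.not_linked_of_linked (by grind) (by grind)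
      (show (2 : Fin 6) < 3 by decide) (show (3 : Fin 6) < 4 by decide)
      (show (4 : Fin 6) < 5 by decide) h'.symm hl
    exact ⟨ψ, hψ, h.isGood_of_three (φ := ψ) (i := 0) (j := 2) (k := 4) (by decide) (by decide)
      (by decide) (by grind) (by grind)⟩
  · obtain ⟨ψ, hψ, hu, ho, ha, hb, hc⟩ := φ.exists_kempeReachableAvoiding_one hzw hzv hwv h3
    have e5 := hc _ hl
    exact ⟨ψ, hψ, h.isGood_of_pairs (φ := ψ) (i := 0) (j := 2) (k := 3) (l := 5) (by decide) (by decide)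
      (by decide) (by grind) (by grind)⟩

/-- Neighbors colored `x z y x w y` in cyclic order. -/
theorem exists_isGood_of_xzyxwy (h : IsCyclicNeighbors G v nb) (hn : [x, y, z, w, φ v].Nodup)
    (h0 : φ (nb 0) = x) (h1 : φ (nb 1) = z) (h2 : φ (nb 2) = y) (h3 : φ (nb 3) = x)
    (h4 : φ (nb 4) = w) (h5 : φ (nb 5) = y) :
    ∃ m ≤ 2, ∃ ψ, KempeReachableAvoiding (φ v) m φ ψ ∧ ψ.IsGood v := by
  obtain ⟨⟨hxy, hxz, hxw, hxv⟩, ⟨hyz, hyw, hyv⟩, ⟨hzw, hzv⟩, hwv⟩ :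
    (x ≠ y ∧ x ≠ z ∧ x ≠ w ∧ x ≠ φ v) ∧ (y ≠ z ∧ y ≠ w ∧ y ≠ φ v) ∧ (z ≠ w ∧ z ≠ φ v) ∧ w ≠ φ v :=
    by simpa using hn
  by_cases hl0 : φ.Linked z x (nb 1) (nb 0)
  · by_cases hl3 : φ.Linked z x (nb 1) (nb 3)
    -- The `x`-`z` chain joins 0 to 3 and separates 4 from 2. After the swap at 4 the colors are `x
    -- z y x y ?`: the last is `y`, giving three alike, or `w`, giving the one-step pattern read
    -- from 2.
    · obtain ⟨ψ, hψ, hu, ho, ha, hb, hc⟩ :=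
        φ.exists_kempeReachableAvoiding_one hyw.symm hwv hyv h4
      have hv : ψ v = φ v := ho v hwv.symm hyv.symm
      have e2 := hc (nb 2) fun h' => h.not_linked_of_linked (by grind) (by grind)
        (show (0 : Fin 6) < 2 by decide) (show (2 : Fin 6) < 3 by decide)
        (show (3 : Fin 6) < 4 by decide) (hl0.symm.trans hl3) h'.symm
      by_cases hl5 : φ.Linked w y (nb 4) (nb 5)
      · obtain ⟨χ, hχ, hg⟩ := (h.rotate 2).exists_isGood_of_xxzyw (φ := ψ) (x := y) (y := x)
          (z := w) (w := z) (by grind) (show ψ (nb 2) = y by grind)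
          (show ψ (nb 4) = y by grind) (show ψ (nb 5) = w by grind)
          (show ψ (nb 0) = x by grind) (show ψ (nb 1) = z by grind)
        exact ⟨2, le_rfl, χ, hψ.trans (hv ▸ hχ), hg⟩
      · have e5 := hc _ hl5
        exact ⟨1, one_le_two, ψ, hψ, h.isGood_of_three (φ := ψ) (i := 2) (j := 4) (k := 5) (by decide)
          (by decide) (by decide) (by grind) (by grind)⟩
    -- Now 0 and 1 exchange colors and 3 keeps its own: `z x y x w y`, the one-step pattern read
    -- from 1.
    · obtain ⟨ψ, hψ, hu, ho, ha, hb, hc⟩ :=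
        φ.exists_kempeReachableAvoiding_one hxz.symm hzv hxv h1
      have hv : ψ v = φ v := ho v hzv.symm hxv.symm
      have e3 := hc _ hl3
      obtain ⟨χ, hχ, hg⟩ := (h.rotate 1).exists_isGood_of_xxzyw (φ := ψ) (x := x) (y := y)
        (z := w) (w := z) (by grind) (show ψ (nb 1) = x by grind)
        (show ψ (nb 3) = x by grind) (show ψ (nb 4) = w by grind)
        (show ψ (nb 5) = y by grind) (show ψ (nb 0) = z by grind)
      exact ⟨2, le_rfl, χ, hψ.trans (hv ▸ hχ), hg⟩
  · obtain ⟨ψ, hψ, hu, ho, ha, hb, hc⟩ :=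
      φ.exists_kempeReachableAvoiding_one hxz.symm hzv hxv h1
    have e0 := hc _ hl0
    exact ⟨1, one_le_two, ψ, hψ, h.isGood_of_pairs (φ := ψ) (i := 0) (j := 1) (k := 2) (l := 5) (by decide)
      (by decide) (by decide) (by grind) (by grind)⟩

/-- Neighbors colored `x y z x y z` in cyclic order. -/
theorem exists_isGood_of_xyzxyz (h : IsCyclicNeighbors G v nb) (hn : [x, y, z, w, φ v].Nodup)
    (h0 : φ (nb 0) = x) (h1 : φ (nb 1) = y) (h2 : φ (nb 2) = z) (h3 : φ (nb 3) = x)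
    (h4 : φ (nb 4) = y) (h5 : φ (nb 5) = z) :
    ∃ m ≤ 3, ∃ ψ, KempeReachableAvoiding (φ v) m φ ψ ∧ ψ.IsGood v := by
  obtain ⟨⟨hxy, hxz, hxw, hxv⟩, ⟨hyz, hyw, hyv⟩, ⟨hzw, hzv⟩, hwv⟩ :
    (x ≠ y ∧ x ≠ z ∧ x ≠ w ∧ x ≠ φ v) ∧ (y ≠ z ∧ y ≠ w ∧ y ≠ φ v) ∧ (z ≠ w ∧ z ≠ φ v) ∧ w ≠ φ v :=
    by simpa using hn
  by_cases hl : φ.Linked z w (nb 2) (nb 5)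
  -- The `z`-`w` chain separates 0 and 1 from 3 and 4. The swap at 0 gives `y x z x y z`, with
  -- nested pairs, or `y y z x y z`, with three alike.
  · obtain ⟨ψ, hψ, hu, ho, ha, hb, hc⟩ := φ.exists_kempeReachableAvoiding_one hxy hxv hyv h0
    have e3 := hc (nb 3) fun h' => h.not_linked_of_linked (by grind) (by grind)
      (show (0 : Fin 6) < 2 by decide) (show (2 : Fin 6) < 3 by decide)
      (show (3 : Fin 6) < 5 by decide) h' hl
    have e4 := hc (nb 4) fun h' => h.not_linked_of_linked (by grind) (by grind)
      (show (0 : Fin 6) < 2 by decide) (show (2 : Fin 6) < 4 by decide)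
      (show (4 : Fin 6) < 5 by decide) h' hl
    refine ⟨1, by decide, ψ, hψ, ?_⟩
    by_cases hl1 : φ.Linked x y (nb 0) (nb 1)
    · exact h.isGood_of_nested (φ := ψ) (i := 0) (j := 1) (k := 3) (l := 4) (by decide) (by decide)
        (by decide) (by grind) (by grind)
    · have e1 := hc _ hl1
      exact h.isGood_of_three (φ := ψ) (i := 0) (j := 1) (k := 4) (by decide) (by decide)
        (by decide) (by grind) (by grind)
  -- The swap at 2 gives `x y w x y z`, the two-step pattern read from 1.
  · obtain ⟨ψ, hψ, hu, ho, ha, hb, hc⟩ := φ.exists_kempeReachableAvoiding_one hzw hzv hwv h2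
    have hv : ψ v = φ v := ho v hzv.symm hwv.symm
    have e5 := hc _ hl
    obtain ⟨m, hm, χ, hχ, hg⟩ := (h.rotate 1).exists_isGood_of_xzyxwy (φ := ψ) (x := y) (y := x)
      (z := w) (w := z) (by grind) (show ψ (nb 1) = y by grind) (show ψ (nb 2) = w by grind)
      (show ψ (nb 3) = x by grind) (show ψ (nb 4) = y by grind)
      (show ψ (nb 5) = z by grind) (show ψ (nb 0) = x by grind)
    exact ⟨1 + m, by omega, χ, hψ.trans (hv ▸ hχ), hg⟩

end IsCyclicNeighbors

/-- The six cyclically arranged colors `a b c d e f` contain, in a fixed position, three equal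
colors, two non-crossing pairs of equal colors, or one of the three remaining patterns. -/
def CyclicPattern (a b c d e f : Fin 4) : Prop :=
  (a = b ∧ (a = c ∨ a = d ∨ a = e) ∨ a = c ∧ a = e) ∨
  (a = b ∧ (c = d ∨ c = e ∨ c = f ∨ d = e ∨ d = f ∨ e = f) ∨ a = c ∧ d = f) ∨
  (a = c ∧ [a, e, d, f].Nodup) ∨
  (a = d ∧ c = f ∧ [a, c, b, e].Nodup) ∨
  (a = d ∧ b = e ∧ c = f ∧ [a, b, c].Nodup)

instance (a b c d e f : Fin 4) : Decidable (CyclicPattern a b c d e f) := by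
  unfold CyclicPattern
  infer_instance

theorem cyclicPattern_rotate : ∀ a b c d e f : Fin 4,
    CyclicPattern a b c d e f ∨ CyclicPattern b c d e f a ∨ CyclicPattern c d e f a b ∨
      CyclicPattern d e f a b c ∨ CyclicPattern e f a b c d ∨ CyclicPattern f a b c d e := by
  decide +kernel

theorem exists_cyclicPattern (c : Fin 6 → Fin 4) :
    ∃ s, CyclicPattern (c (0 + s)) (c (1 + s)) (c (2 + s)) (c (3 + s)) (c (4 + s)) (c (5 + s)) := by
  rcases cyclicPattern_rotate (c 0) (c 1) (c 2) (c 3) (c 4) (c 5) with h | h | h | h | h | h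
  exacts [⟨0, h⟩, ⟨1, h⟩, ⟨2, h⟩, ⟨3, h⟩, ⟨4, h⟩, ⟨5, h⟩]

namespace IsCyclicNeighbors

variable {v : V} {nb : Fin 6 → V} {φ : G.Coloring (Fin 5)}

theorem exists_isGood_of_cyclicPattern (h : IsCyclicNeighbors G v nb) (c : Fin 6 → Fin 4)
    (hc : ∀ i, (φ v).succAbove (c i) = φ (nb i))
    (hp : CyclicPattern (c 0) (c 1) (c 2) (c 3) (c 4) (c 5)) :
    ∃ m ≤ 3, ∃ ψ, KempeReachableAvoiding (φ v) m φ ψ ∧ ψ.IsGood v := by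
  have heq : ∀ {i j}, c i = c j → φ (nb i) = φ (nb j) := fun {i j} hij => by
    rw [← hc, ← hc, hij]
  have hnodup : ∀ {i j k l}, [c i, c j, c k, c l].Nodup →
      [φ (nb i), φ (nb j), φ (nb k), φ (nb l), φ v].Nodup := fun {i j k l} hn => by
    have := hn.map (Fin.succAbove_right_injective (p := φ v))
    simp only [List.map, hc] at this
    have hv : ∀ i, φ (nb i) ≠ φ v := fun i => hc i ▸ Fin.succAbove_ne _ _
    have := hv i
    have := hv j
    have := hv k
    have := hv l
    grind
  have hnil : φ.IsGood v → ∃ m ≤ 3, ∃ ψ, KempeReachableAvoiding (φ v) m φ ψ ∧ ψ.IsGood v :=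
    fun hg => ⟨0, by decide, φ, ⟨fun _ => φ, rfl, rfl, by simp⟩, hg⟩
  rcases hp with hp | hp | ⟨e1, hn⟩ | ⟨e1, e2, hn⟩ | ⟨e1, e2, e3, hn⟩
  · refine hnil ?_
    rcases hp with ⟨e, e' | e' | e'⟩ | ⟨e, e'⟩
    · exact h.isGood_of_three (i := 1) (j := 0) (k := 2) (by decide) (by decide) (by decide)
        (heq e.symm) (heq e')
    · exact h.isGood_of_three (i := 1) (j := 0) (k := 3) (by decide) (by decide) (by decide)
        (heq e.symm) (heq e')
    · exact h.isGood_of_three (i := 1) (j := 0) (k := 4) (by decide) (by decide) (by decide)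
        (heq e.symm) (heq e')
    · exact h.isGood_of_three (i := 2) (j := 0) (k := 4) (by decide) (by decide) (by decide)
        (heq e.symm) (heq e')
  · refine hnil ?_
    rcases hp with ⟨e, e' | e' | e' | e' | e' | e'⟩ | ⟨e, e'⟩ <;>
      exact h.isGood_of_pairs (by decide) (by decide) (by decide) (heq e) (heq e')
  · obtain ⟨ψ, hψ⟩ := h.exists_isGood_of_xxzyw (hnodup hn) rfl (heq e1.symm) rfl rfl rfl
    exact ⟨1, by decide, ψ, hψ⟩
  · obtain ⟨m, hm, ψ, hψ⟩ := h.exists_isGood_of_xzyxwy (hnodup hn) rfl rfl rfl (heq e1.symm) rfl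
      (heq e2.symm)
    exact ⟨m, by omega, ψ, hψ⟩
  -- Three colors on the neighbors and that of `v` leave a fifth, `w`, for the chains.
  · obtain ⟨w, hw⟩ : ∃ w : Fin 5, [φ (nb 0), φ (nb 1), φ (nb 2), w, φ v].Nodup := by
      have hv : ∀ i, φ (nb i) ≠ φ v := fun i => hc i ▸ Fin.succAbove_ne _ _
      obtain ⟨w, hw⟩ : ∃ w : Fin 5, w ∉ ({φ (nb 0), φ (nb 1), φ (nb 2), φ v} : Finset (Fin 5)) := by
        by_contra! hall
        have h1 := Finset.card_le_four (a := φ (nb 0)) (b := φ (nb 1)) (c := φ (nb 2)) (d := φ v)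
        rw [Finset.eq_univ_of_forall hall] at h1
        simp at h1
      have h3 := hn.map (Fin.succAbove_right_injective (p := φ v))
      simp only [List.map, hc] at h3
      have := hv 0
      have := hv 1
      have := hv 2
      refine ⟨w, ?_⟩
      simp only [Finset.mem_insert, Finset.mem_singleton, not_or] at hw
      grind
    exact h.exists_isGood_of_xyzxyz hw rfl rfl rfl (heq e1.symm) (heq e2.symm) (heq e3.symm)

end IsCyclicNeighbors

end

theorem mainTheorem6 {V : Type*} [Fintype V] (N : SimpleGraph V) [DecidableRel N.Adj]
    (_D : N.PlaneDrawing) (α : N.Coloring (Fin 5)) (v : V) (_hv : N.degree v = 6) :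
    ∃ (m : ℕ) (β : N.Coloring (Fin 5)), m ≤ 3 ∧
      SimpleGraph.Coloring.KempeReachableAvoiding (α v) m α β ∧ β.IsGood v := by
  obtain ⟨nb, h⟩ := exists_isCyclicNeighbors _D _hv
  -- Omitting `α v` turns the neighbor colors into elements of `Fin 4`, for the finite check.
  choose c hc using fun i => Fin.exists_succAbove_eq (α.valid (h.adj i)).symm
  obtain ⟨s, hs⟩ := exists_cyclicPattern c
  obtain ⟨m, hm, β, hβ⟩ := (h.rotate s).exists_isGood_of_cyclicPattern (fun i => c (i + s))
    (fun i => hc (i + s)) hs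
  exact ⟨m, β, hm, hβ⟩
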